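/- For a permutation $\pi=a_1a_2\cdots a_n$ of $\{1,\dots,n\}$, an index $i\in\{1,\dots,n-1\}$ is a descent if $a_i>a_{i+1}$. Let $\mathrm{des}(\pi)$, $\mathrm{odes}(\pi)$ and $\mathrm{edes}(\pi)$ be the numbers of descents of $\pi$, of its descents $i$ with $i$ odd, and of its descents $i$ with $i$ even. Let $$A_n(q)=\sum_{\pi\in\mathfrak S_n}q^{\mathrm{des}(\pi)},\qquad A_n(p,q)=\sum_{\pi\in\mathfrak S_n}p^{\mathrm{odes}(\pi)}q^{\mathrm{edes}(\pi)},$$ $$\mathcal E(q;t)=1+\sum_{n\ge1}A_n(q)\frac{t^n}{n!},\qquad A^{(e)}(p,q;t)=\sum_{n\ge1}A_{2n}(p,q)\frac{t^{2n}}{(2n)!},\qquad A^{(o)}(p,q;t)=\sum_{n\ge0}A_{2n+1}(p,q)\frac{t^{2n+1}}{(2n+1)!}.$$ Put $y=\frac{p+q}{2(1+pq)}$ and $x=y\,C(y^2)$, where $C(z)=\frac{1-\sqrt{1-4z}}{2z}=\sum_{n\ge0}\frac1{n+1}\binom{2n}{n}z^n$ is the generating function of the Catalan numbers, and let $s=\sqrt{\frac{1+pq}{1+x^2}}$.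 **Theorem 2.2.** There hold $$A^{(e)}(p,q;t)=\frac{1+x}{1+q}\left\{\frac{\mathcal E(x;st)+\mathcal E(x;-st)}{2}-1\right\},\qquad A^{(o)}(p,q;t)=\frac{\mathcal E(x;st)-\mathcal E(x;-st)}{2s},$$ where $\mathcal E(x;t)$ has the closed form $\mathcal E(x;t)=\frac{1-x}{e^{t(x-1)}-x}$, in the sense that $\mathcal E(x;t)\,(e^{t(x-1)}-x)=1-x$ (so for $x=1$ the closed form asserts nothing). This holds in both of the following senses: 1. as an identity of formal power series in the indeterminates $p,q,t$ over $\mathbb Q$, where $C$ is the Catalan power series and the square root is the one with constant term $1$; 2. for all complex numbers $p,q$ with $1+pq\ne0$ and $1+q\ne0$, as an identity of formal power series in $t$ over $\mathbb C$, where square roots are principal and $C(0)=1$. -/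

import Mathlib

open scoped Nat

namespace RefinedEulerian

/-- For `π = a₁ a₂ ⋯ aₙ` (with letters `0, …, n - 1`), the position `i`, `1 ≤ i ≤ n - 1`, is a
descent if `aᵢ > aᵢ₊₁`.  The letter `aᵢ` is `π` at the element of `Fin n` with value `i - 1`. -/
def IsDescent {n : ℕ} (π : Equiv.Perm (Fin n)) (i : ℕ) : Prop :=
  1 ≤ i ∧ ∃ h : i < n, π ⟨i, h⟩ < π ⟨i - 1, by omega⟩

instance {n : ℕ} (π : Equiv.Perm (Fin n)) (i : ℕ) : Decidable (IsDescent π i) :=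
  inferInstanceAs (Decidable (1 ≤ i ∧ ∃ h : i < n, π ⟨i, h⟩ < π ⟨i - 1, by omega⟩))

/-- The set of descents of `π`, a subset of `{1, …, n - 1}`. -/
def descents {n : ℕ} (π : Equiv.Perm (Fin n)) : Finset ℕ :=
  (Finset.Ico 1 n).filter (fun i => IsDescent π i)

/-- Number of descents. -/
def des {n : ℕ} (π : Equiv.Perm (Fin n)) : ℕ := (descents π).card

/-- Number of descents in odd positions. -/
def odes {n : ℕ} (π : Equiv.Perm (Fin n)) : ℕ := ((descents π).filter (fun i => Odd i)).card

/-- Number of descents in even positions. -/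
def edes {n : ℕ} (π : Equiv.Perm (Fin n)) : ℕ := ((descents π).filter (fun i => Even i)).card

section EGF

variable {R : Type*} [CommRing R]

/-- The (classical) Eulerian polynomial `A_n`, at `a`. -/
def eulerianPoly (n : ℕ) (a : R) : R := ∑ π : Equiv.Perm (Fin n), a ^ des π

/-- The refined Eulerian polynomial `A_n`, at `(p, q)`. -/
def refinedEulerianPoly (n : ℕ) (p q : R) : R :=
  ∑ π : Equiv.Perm (Fin n), p ^ odes π * q ^ edes π

variable [Algebra ℚ R]

/-- The exponential generating function `1 + ∑_{n ≥ 1} A_n(a) t ^ n / n!`, a power series in `t`. -/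
noncomputable def eulerianEGF (a : R) : PowerSeries R :=
  PowerSeries.mk fun n => (1 / (n ! : ℚ)) • eulerianPoly n a

/-- `∑_{n ≥ 1} A_{2n}(p, q) t ^ (2n) / (2n)!`, a power series in `t`. -/
noncomputable def evenEGF (p q : R) : PowerSeries R :=
  PowerSeries.mk fun n =>
    if 1 ≤ n ∧ Even n then (1 / (n ! : ℚ)) • refinedEulerianPoly n p q else 0

/-- `∑_{n ≥ 0} A_{2n+1}(p, q) t ^ (2n+1) / (2n+1)!`, a power series in `t`. -/
noncomputable def oddEGF (p q : R) : PowerSeries R :=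
  PowerSeries.mk fun n => if Odd n then (1 / (n ! : ℚ)) • refinedEulerianPoly n p q else 0

end EGF

section Formal

/-- The formal square root `∑_k binom(1/2, k) (f - 1) ^ k` of a power series `f` with constant
term `1` over `ℚ`. -/
noncomputable def formalSqrt {σ : Type*} (f : MvPowerSeries σ ℚ) : MvPowerSeries σ ℚ :=
  (PowerSeries.binomialSeries ℚ (1 / 2 : ℚ)).subst (f - 1)

theorem formalSqrt_sq {σ : Type*} (f : MvPowerSeries σ ℚ)
    (hf : MvPowerSeries.constantCoeff f = 1) : formalSqrt f ^ 2 = f := by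
  have hs : PowerSeries.HasSubst (f - 1) :=
    PowerSeries.HasSubst.of_constantCoeff_zero (by simp [hf])
  have h := PowerSeries.binomialSeries_add (A := ℚ) (1 / 2 : ℚ) (1 / 2 : ℚ)
  have h1 := PowerSeries.binomialSeries_nat (R := ℚ) (A := ℚ) 1
  norm_num at h h1
  rw [h1] at h
  rw [formalSqrt, sq, ← PowerSeries.subst_mul hs]
  norm_num
  rw [← h, PowerSeries.subst_add hs, PowerSeries.subst_X hs, ← PowerSeries.coe_substAlgHom hs,
    map_one]
  ring

/-- The Catalan generating function `C(z) = ∑_n C_n z ^ n` over `ℚ`. -/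
noncomputable def catalanGF : PowerSeries ℚ :=
  PowerSeries.map (Nat.castRingHom ℚ) PowerSeries.catalanSeries

/-- `2 z C(z) = 1 - √(1 - 4 z)` for the formal square root. -/
theorem catalanGF_closed_form :
    2 * PowerSeries.X * catalanGF = 1 - formalSqrt (1 - 4 * PowerSeries.X : PowerSeries ℚ) := by
  have hc : catalanGF ^ 2 * PowerSeries.X + 1 = catalanGF := by
    have h := congrArg (PowerSeries.map (Nat.castRingHom ℚ))
      PowerSeries.catalanSeries_sq_mul_X_add_one
    simpa [catalanGF] using h
  have h0 : PowerSeries.constantCoeff (1 - 4 * PowerSeries.X : PowerSeries ℚ) = 1 := by simp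
  have hq : formalSqrt (1 - 4 * PowerSeries.X : PowerSeries ℚ) ^ 2 = 1 - 4 * PowerSeries.X :=
    formalSqrt_sq _ h0
  have hz : PowerSeries.constantCoeff (formalSqrt (1 - 4 * PowerSeries.X : PowerSeries ℚ)) = 1 := by
    have hf : MvPowerSeries.constantCoeff ((1 - 4 * PowerSeries.X : PowerSeries ℚ) - 1) = 0 := by
      change PowerSeries.constantCoeff ((1 - 4 * PowerSeries.X : PowerSeries ℚ) - 1) = 0
      simp
    have hs : PowerSeries.HasSubst ((1 - 4 * PowerSeries.X : PowerSeries ℚ) - 1) :=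
      PowerSeries.HasSubst.of_constantCoeff_zero hf
    have h := PowerSeries.constantCoeff_subst_eq_zero hf
      (PowerSeries.binomialSeries ℚ (1 / 2 : ℚ) - 1) (by simp)
    rw [← PowerSeries.coe_substAlgHom hs, map_sub, map_one, map_sub, map_one, sub_eq_zero,
      PowerSeries.coe_substAlgHom hs] at h
    exact h
  have hsq : (1 - 2 * PowerSeries.X * catalanGF) ^ 2 =
      formalSqrt (1 - 4 * PowerSeries.X : PowerSeries ℚ) ^ 2 := by
    rw [hq]; linear_combination (4 * PowerSeries.X) * hc
  rcases sq_eq_sq_iff_eq_or_eq_neg.mp hsq with h | h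
  · rw [← h]; ring
  · have := congrArg PowerSeries.constantCoeff h
    rw [map_neg, hz] at this
    simp at this
    norm_num at this

/-- `C(g)` for a power series `g` over `ℚ` without constant term. -/
noncomputable def formalCatalan {σ : Type*} (g : MvPowerSeries σ ℚ) : MvPowerSeries σ ℚ :=
  catalanGF.subst g

end Formal

/-- `C(z) = (1 - √(1 - 4 z)) / (2 z)` on `ℂ` (principal square root), with its value `C(0) = 1` at
the removable singularity. -/
noncomputable def complexCatalan (z : ℂ) : ℂ :=
  if z = 0 then 1 else (1 - Complex.sqrt (1 - 4 * z)) / (2 * z)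

end RefinedEulerian

/-! Give each descent position `i` a weight `w i`. If `f n j` is the weighted count of permutations
of size `n` with last letter `j`, appending a letter shows that `f (n+1) j` is a constant plus `(1 -
w n) * ∑ i < j, f n i`. A forward difference in `j` thus lowers the size by one, and Newton's
formula yields a recurrence for the total weight (`weightSum_eq_sum_antidiagonal`).

For weights alternating between `p` and `q`, this recurrence is a 2×2 linear system for the even and
odd generating functions `E` and `O`. With `c = (1-p)(1-q)`, `H = (cosh(√c t) - 1)/c`, `S = sinh(√c
t)/√c` and `D = 1 - (p+q)H`, its solution is `E = (1+p)H/D`, `O = S/D`.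

So `(1+q)E` and `O` depend only on `p+q` and `pq`. Replacing `(p,q)` by `(x,x)` and `t` by `st`
gives the same functions, up to factors `1+x` and `s`, once `2xs² = p+q` and `(1+x²)s² = 1+pq`
(`egf_eq_rescale`). Eliminating `s` leaves `x = y(1+x²)`, the Catalan equation. Writing `H` and `S`
as series in `c` avoids division by `c`, so `c = 0` is no exception. -/

namespace RefinedEulerian

/-! ### Permutations built by appending a last letter -/

/-- The permutation of `Fin (n + 1)` with last letter `j` whose other letters are order isomorphic
to `σ`. -/
def insertLast {n : ℕ} (j : Fin (n + 1)) (σ : Equiv.Perm (Fin n)) : Equiv.Perm (Fin (n + 1)) :=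
  ((finSuccEquiv' (Fin.last n)).trans σ.optionCongr).trans (finSuccEquiv' j).symm

@[simp]
theorem insertLast_last {n : ℕ} (j : Fin (n + 1)) (σ : Equiv.Perm (Fin n)) :
    insertLast j σ (Fin.last n) = j := by
  simp [insertLast]

@[simp]
theorem insertLast_castSucc {n : ℕ} (j : Fin (n + 1)) (σ : Equiv.Perm (Fin n)) (i : Fin n) :
    insertLast j σ i.castSucc = j.succAbove (σ i) := by
  simp [insertLast, finSuccEquiv'_last_apply_castSucc]

theorem insertLast_bijective (n : ℕ) :
    Function.Bijective fun a : Fin (n + 1) × Equiv.Perm (Fin n) => insertLast a.1 a.2 := by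
  rw [Fintype.bijective_iff_injective_and_card]
  refine ⟨?_, by simp [Fintype.card_perm, Nat.factorial_succ]⟩
  rintro ⟨j, σ⟩ ⟨k, τ⟩ h
  have hj : j = k := by simpa using DFunLike.congr_fun h (Fin.last n)
  subst hj
  congr 1
  ext1 i
  exact Fin.succAbove_right_injective (p := j) (by simpa using DFunLike.congr_fun h i.castSucc)

/-! ### Recurrence for arbitrary position weights -/

section Weight

variable {R : Type*} [CommRing R] (w : ℕ → R)

/-- The product of the weights of the descents of `π`. -/
def descentWeight {n : ℕ} (π : Equiv.Perm (Fin n)) : R := ∏ i ∈ descents π, w i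

/-- The sum of the descent weights of all permutations of size `n`. -/
def weightSum (n : ℕ) : R := ∑ π : Equiv.Perm (Fin n), descentWeight w π

/-- The sum of the descent weights of all permutations with last letter `j`. -/
def lastWeightSum {n : ℕ} (j : Fin (n + 1)) : R :=
  ∑ σ : Equiv.Perm (Fin n), descentWeight w (insertLast j σ)

theorem sum_perm_succ {n : ℕ} (f : Equiv.Perm (Fin (n + 1)) → R) :
    ∑ π, f π = ∑ j, ∑ σ : Equiv.Perm (Fin n), f (insertLast j σ) := by
  rw [← Fintype.sum_prod_type', ← (insertLast_bijective n).sum_comp]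

theorem weightSum_succ (n : ℕ) :
    weightSum w (n + 1) = ∑ j : Fin (n + 1), lastWeightSum w j :=
  sum_perm_succ _

theorem descentWeight_eq_prod_ite {n : ℕ} (π : Equiv.Perm (Fin n)) :
    descentWeight w π = ∏ i ∈ Finset.Ico 1 n, if IsDescent π i then w i else 1 := by
  rw [descentWeight, descents, Finset.prod_filter]

theorem isDescent_insertLast {n i : ℕ} (j : Fin (n + 1)) (σ : Equiv.Perm (Fin n)) (hi : i < n) :
    IsDescent (insertLast j σ) i ↔ IsDescent σ i := by
  unfold IsDescent
  refine and_congr_right fun h1 => ?_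
  have e1 : insertLast j σ ⟨i, by omega⟩ = j.succAbove (σ ⟨i, hi⟩) :=
    insertLast_castSucc j σ ⟨i, hi⟩
  have e2 : insertLast j σ ⟨i - 1, by omega⟩ = j.succAbove (σ ⟨i - 1, by omega⟩) :=
    insertLast_castSucc j σ ⟨i - 1, by omega⟩
  constructor
  · rintro ⟨h, hlt⟩
    rw [e1, e2, Fin.succAbove_lt_succAbove_iff] at hlt
    exact ⟨hi, hlt⟩
  · rintro ⟨h, hlt⟩
    refine ⟨by omega, ?_⟩
    rwa [e1, e2, Fin.succAbove_lt_succAbove_iff]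

/-- The inequality is weak because old letters that are at least `j` move up by one. -/
theorem isDescent_insertLast_last {n : ℕ} (j : Fin (n + 2)) (σ : Equiv.Perm (Fin (n + 1))) :
    IsDescent (insertLast j σ) (n + 1) ↔ j ≤ (σ (Fin.last n)).castSucc := by
  have e1 : insertLast j σ ⟨n + 1, by omega⟩ = j := insertLast_last j σ
  have e2 : insertLast j σ ⟨n + 1 - 1, by omega⟩ = j.succAbove (σ (Fin.last n)) :=
    insertLast_castSucc j σ (Fin.last n)
  rw [← Fin.lt_succAbove_iff_le_castSucc, ← e2]
  unfold IsDescent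
  simp [e1]

theorem descentWeight_insertLast {n : ℕ} (j : Fin (n + 2)) (σ : Equiv.Perm (Fin (n + 1))) :
    descentWeight w (insertLast j σ) =
      descentWeight w σ * if j ≤ (σ (Fin.last n)).castSucc then w (n + 1) else 1 := by
  rw [descentWeight_eq_prod_ite, descentWeight_eq_prod_ite,
    Finset.prod_Ico_succ_top (by omega : 1 ≤ n + 1)]
  simp only [isDescent_insertLast_last]
  congr 1
  refine Finset.prod_congr rfl fun i hi => ?_
  simp only [isDescent_insertLast j σ (Finset.mem_Ico.mp hi).2]

theorem lastWeightSum_succ {n : ℕ} (j : Fin (n + 2)) :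
    lastWeightSum w j =
      ∑ i : Fin (n + 1), lastWeightSum w i * if j ≤ i.castSucc then w (n + 1) else 1 := by
  simp only [lastWeightSum, descentWeight_insertLast]
  rw [sum_perm_succ]
  simp [Finset.sum_mul]

/-- The weight of the descent between a word of length `n` and a smaller letter that follows it,
which is `1` if the word is empty. -/
def descentFactor (n : ℕ) : R := if n = 0 then 1 else w n

/-- The interpolation to `ℕ` of the sums of the weights of the permutations of size `n` with given
last letter. -/
def lastWeightInterp : ℕ → ℕ → R
  -- The value 0 at size 0 removes the meaningless `w 0`, so that size 1 gives the constant 1.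
  | 0, _ => 0
  | n + 1, j => descentFactor w n * weightSum w n +
      (1 - w n) * ∑ i ∈ Finset.range j, lastWeightInterp n i

@[simp]
theorem weightSum_zero : weightSum w 0 = 1 := by
  simp [weightSum, descentWeight, descents]

/-- Appending `j` after last letter `i` costs `w` if `j ≤ i` and 1 otherwise, so the sum is `w`
times the full total plus `1 - w` times the part with `i < j`. -/
theorem lastWeightSum_eq_interp (n : ℕ) (j : Fin (n + 1)) :
    lastWeightSum w j = lastWeightInterp w (n + 1) j := by
  induction n with
  | zero =>
    simp [lastWeightSum, descentWeight, descents, lastWeightInterp, descentFactor]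
  | succ n ih =>
    rw [lastWeightSum_succ, lastWeightInterp, weightSum_succ]
    simp only [ih, descentFactor, Nat.add_eq_zero_iff, one_ne_zero, and_false, if_false]
    have hj : Finset.range (j : ℕ) = (Finset.range (n + 1)).filter (fun i => ¬ (j : ℕ) ≤ i) := by
      ext i
      have := j.2
      simp only [Finset.mem_range, Finset.mem_filter]
      omega
    rw [hj, Finset.sum_filter, ← Fin.sum_univ_eq_sum_range
      (fun i => if ¬ (j : ℕ) ≤ i then lastWeightInterp w (n + 1) i else 0), Finset.mul_sum,
      Finset.mul_sum, ← Finset.sum_add_distrib]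
    refine Finset.sum_congr rfl fun i _ => ?_
    simp only [Fin.le_def, Fin.val_castSucc]
    split_ifs <;> first | contradiction | ring

theorem weightSum_eq_sum_interp {n : ℕ} (hn : n ≠ 0) :
    weightSum w n = ∑ i ∈ Finset.range n, lastWeightInterp w n i := by
  obtain ⟨n, rfl⟩ := Nat.exists_eq_succ_of_ne_zero hn
  rw [Nat.succ_eq_add_one, weightSum_succ, ← Fin.sum_univ_eq_sum_range]
  exact Finset.sum_congr rfl fun j _ => lastWeightSum_eq_interp w n j

/-- The first summand of the recursion is constant in `j`, and differencing the partial sums returns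
their summand: each difference lowers the size by one at the cost of a factor `1 - w`. -/
theorem fwdDiff_iter_interp (m k : ℕ) :
    (fwdDiff 1)^[k] (lastWeightInterp w (m + 1 + k)) =
      fun j => (∏ i ∈ Finset.range k, (1 - w (m + 1 + i))) * lastWeightInterp w (m + 1) j := by
  induction k with
  | zero => simp
  | succ k ih =>
    have h : fwdDiff 1 (lastWeightInterp w (m + 1 + k + 1)) =
        (1 - w (m + 1 + k)) • lastWeightInterp w (m + 1 + k) := by
      ext j
      simp [fwdDiff, lastWeightInterp, Finset.sum_range_succ, mul_add]
    rw [← add_assoc, Function.iterate_succ_apply, h, fwdDiff_iter_const_smul, ih]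
    ext j
    simp [Finset.prod_range_succ]
    ring

/-- Decomposition of the permutations of size `n` by their last maximal increasing runs. -/
theorem weightSum_eq_sum_antidiagonal {n : ℕ} (hn : n ≠ 0) :
    weightSum w n = ∑ a ∈ Finset.HasAntidiagonal.antidiagonal n, if a.1 = 0 then 0 else
      (n.choose a.1 : R) * ((∏ i ∈ Finset.range (a.1 - 1), (1 - w (a.2 + 1 + i))) *
        (descentFactor w a.2 * weightSum w a.2)) := by
  -- Newton's forward difference formula from 0 to `n`, applied to the partial sums. At 0 these
  -- vanish, and so do the partial sums inside the recursion, leaving only its constant term.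
  have h := shift_eq_sum_fwdDiff_iter (1 : ℕ)
    (fun j => ∑ i ∈ Finset.range j, lastWeightInterp w n i) n 0
  simp only [zero_add, smul_eq_mul, mul_one] at h
  rw [weightSum_eq_sum_interp w hn, h, Finset.Nat.sum_antidiagonal_eq_sum_range_succ_mk]
  refine Finset.sum_congr rfl fun k hk => ?_
  rcases k with _ | k
  · simp
  · have hk' : k < n := by simpa using hk
    have h1 : fwdDiff 1 (fun j => ∑ i ∈ Finset.range j, lastWeightInterp w n i) =
        lastWeightInterp w n := by
      ext j
      simp [fwdDiff, Finset.sum_range_succ]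
    have h2 := fwdDiff_iter_interp w (n - (k + 1)) k
    rw [show n - (k + 1) + 1 + k = n by omega] at h2
    rw [Function.iterate_succ_apply, h1, h2]
    simp [lastWeightInterp]

end Weight

/-! ### Weights alternating with the parity of the position -/

section Parity

variable {R : Type*} [CommRing R] (p q : R)

/-- The weight `p` on odd positions and `q` on even positions. -/
def parityWeight (i : ℕ) : R := if Odd i then p else q

theorem refinedEulerianPoly_eq_weightSum (n : ℕ) :
    refinedEulerianPoly n p q = weightSum (parityWeight p q) n := by
  refine Finset.sum_congr rfl fun π _ => ?_
  rw [descentWeight, odes, edes]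
  simp only [parityWeight, Finset.prod_ite, Finset.prod_const, Nat.not_odd_iff_even]

theorem refinedEulerianPoly_self (n : ℕ) (a : R) :
    refinedEulerianPoly n a a = eulerianPoly n a := by
  rw [refinedEulerianPoly_eq_weightSum]
  simp [weightSum, descentWeight, parityWeight, eulerianPoly, des]

theorem prod_one_sub_parityWeight_of_even {m : ℕ} (hm : Even m) (k : ℕ) :
    ∏ i ∈ Finset.range k, (1 - parityWeight p q (m + 1 + i)) =
      (if Even k then 1 else 1 - p) * ((1 - p) * (1 - q)) ^ (k / 2) := by
  induction k with
  | zero => simp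
  | succ k ih =>
    rw [Finset.prod_range_succ, ih, parityWeight]
    rcases Nat.even_or_odd' k with ⟨l, rfl | rfl⟩
    · have h : Odd (m + 1 + 2 * l) := by grind
      simp [h, show (2 * l + 1) / 2 = l by omega]
      ring
    · have h : ¬ Odd (m + 1 + (2 * l + 1)) := by grind
      simp [h, show (2 * l + 1) / 2 = l by omega, show (2 * l + 1 + 1) / 2 = l + 1 by omega,
        Nat.even_add_one]
      ring

theorem prod_one_sub_parityWeight_of_odd {m : ℕ} (hm : Odd m) (k : ℕ) :
    ∏ i ∈ Finset.range k, (1 - parityWeight p q (m + 1 + i)) =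
      (if Even k then 1 else 1 - q) * ((1 - p) * (1 - q)) ^ (k / 2) := by
  -- Shifting all positions by one exchanges `p` and `q`.
  rw [mul_comm (1 - p), ← prod_one_sub_parityWeight_of_even q p hm.add_one]
  refine Finset.prod_congr rfl fun i _ => ?_
  unfold parityWeight
  split_ifs with h1 h2 h2 <;> first | rfl | (exfalso; grind)

end Parity

/-! ### Generating functions: linear system, solution and rescaling -/

section EGF

theorem rescale_C {R : Type*} [CommRing R] (s a : R) :
    PowerSeries.rescale s (PowerSeries.C a) = PowerSeries.C a := by
  ext n
  rw [PowerSeries.coeff_rescale, PowerSeries.coeff_C]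
  split_ifs with h <;> simp [h]

variable {R : Type*} [CommRing R] [Algebra ℚ R]

/-- The exponential generating function of a sequence. -/
noncomputable def egf (a : ℕ → R) : PowerSeries R :=
  PowerSeries.mk fun n => (1 / (n ! : ℚ)) • a n

@[simp]
theorem coeff_egf (a : ℕ → R) (n : ℕ) : PowerSeries.coeff n (egf a) = (1 / (n ! : ℚ)) • a n :=
  PowerSeries.coeff_mk _ _

theorem egf_mul (a b : ℕ → R) :
    egf a * egf b = egf fun n => ∑ i ∈ Finset.HasAntidiagonal.antidiagonal n,
      (n.choose i.1 : R) * (a i.1 * b i.2) := by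
  ext n
  rw [PowerSeries.coeff_mul, coeff_egf, Finset.smul_sum]
  refine Finset.sum_congr rfl fun i hi => ?_
  obtain rfl : i.1 + i.2 = n := by simpa using hi
  have h : (((i.1 + i.2).choose i.1 : ℕ) : R) = algebraMap ℚ R ((i.1 + i.2).choose i.1 : ℚ) := by
    simp
  rw [coeff_egf, coeff_egf, smul_mul_smul_comm, h, ← Algebra.smul_def, smul_smul]
  congr 1
  rw [Nat.cast_add_choose]
  have := Nat.factorial_ne_zero (i.1 + i.2)
  field_simp

theorem egf_add (a b : ℕ → R) : egf a + egf b = egf fun n => a n + b n := by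
  ext n
  simp

theorem C_mul_egf (c : R) (a : ℕ → R) : PowerSeries.C c * egf a = egf fun n => c * a n := by
  ext n
  simp

theorem one_eq_egf : (1 : PowerSeries R) = egf fun n => if n = 0 then 1 else 0 := by
  ext n
  rw [PowerSeries.coeff_one, coeff_egf]
  split_ifs with h <;> simp [h]

theorem evenEGF_eq_egf (p q : R) : evenEGF p q = egf fun n =>
    if 1 ≤ n ∧ Even n then refinedEulerianPoly n p q else 0 := by
  ext n
  simp [evenEGF]

theorem oddEGF_eq_egf (p q : R) : oddEGF p q = egf fun n =>
    if Odd n then refinedEulerianPoly n p q else 0 := by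
  ext n
  simp [oddEGF]

/-- The power series `∑_{m ≥ 1} c ^ (m - 1) t ^ (2 m) / (2 m)!`, that is
`(cosh (√c t) - 1) / c`. -/
noncomputable def coshSeries (c : R) : PowerSeries R :=
  egf fun n => if 1 ≤ n ∧ Even n then c ^ (n / 2 - 1) else 0

/-- The power series `∑_m c ^ m t ^ (2 m + 1) / (2 m + 1)!`, that is `sinh (√c t) / √c`. -/
noncomputable def sinhSeries (c : R) : PowerSeries R :=
  egf fun n => if Odd n then c ^ (n / 2) else 0

@[simp]
theorem constantCoeff_coshSeries (c : R) : PowerSeries.constantCoeff (coshSeries c) = 0 := by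
  rw [← PowerSeries.coeff_zero_eq_constantCoeff_apply, coshSeries, coeff_egf]
  simp

@[simp]
theorem constantCoeff_sinhSeries (c : R) : PowerSeries.constantCoeff (sinhSeries c) = 0 := by
  rw [← PowerSeries.coeff_zero_eq_constantCoeff_apply, sinhSeries, coeff_egf]
  simp

theorem derivative_egf (a : ℕ → R) :
    PowerSeries.derivative R (egf a) = egf fun n => a (n + 1) := by
  ext n
  rw [PowerSeries.coeff_derivative, coeff_egf, coeff_egf, mul_comm]
  have h : (n + 1 : R) = algebraMap ℚ R (n + 1) := by simp
  rw [h, ← Algebra.smul_def, smul_smul, Nat.factorial_succ]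
  congr 1
  have := Nat.factorial_ne_zero n
  push_cast
  field_simp

theorem derivative_coshSeries (c : R) :
    PowerSeries.derivative R (coshSeries c) = sinhSeries c := by
  rw [coshSeries, derivative_egf, sinhSeries]
  congr 1
  ext n
  rcases Nat.even_or_odd' n with ⟨l, rfl | rfl⟩
  · simp
  · simp [Nat.even_add_one, show (2 * l + 1) / 2 = l by omega,
      show (2 * l + 1 + 1) / 2 - 1 = l by omega]

theorem derivative_sinhSeries (c : R) :
    PowerSeries.derivative R (sinhSeries c) = 1 + PowerSeries.C c * coshSeries c := by
  rw [sinhSeries, derivative_egf, coshSeries, C_mul_egf, one_eq_egf, egf_add]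
  congr 1
  ext n
  rcases Nat.even_or_odd' n with ⟨l, rfl | rfl⟩
  · rcases l with _ | l
    · simp
    · simp [show (2 * (l + 1) + 1) / 2 = l + 1 by omega, pow_succ']
  · simp [Nat.odd_add_one]

/-- This is `cosh² - sinh² = 1` freed of denominators; both sides have the same derivative and no
constant term. -/
theorem sinhSeries_sq (c : R) :
    sinhSeries c ^ 2 = 2 * coshSeries c + PowerSeries.C c * coshSeries c ^ 2 := by
  have : IsAddTorsionFree R := IsAddTorsionFree.of_module_rat R
  refine PowerSeries.derivative.ext ?_ (by simp)
  have h2 : PowerSeries.derivative R (2 : PowerSeries R) = 0 := by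
    exact_mod_cast (PowerSeries.derivative R).map_natCast 2
  simp only [pow_two, map_add, Derivation.leibniz, derivative_coshSeries, derivative_sinhSeries,
    h2, PowerSeries.derivative_C, smul_eq_mul]
  ring

/-- For even `n = k + m`, the parts `k ≥ 1` and `m` have equal parity. If both are even, the `k - 1`
factors start and end with `1 - p`, and the rest contributes 1 for `m = 0` and `q` times its weight
otherwise. If both are odd, the factors pair up to powers of `c` and the rest carries `p`. -/
theorem evenEGF_linear (p q : R) :
    evenEGF p q = PowerSeries.C (1 - p) * coshSeries ((1 - p) * (1 - q)) *
        (1 + PowerSeries.C q * evenEGF p q) +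
      sinhSeries ((1 - p) * (1 - q)) * (PowerSeries.C p * oddEGF p q) := by
  set c := (1 - p) * (1 - q) with hc
  rw [evenEGF_eq_egf, oddEGF_eq_egf, coshSeries, sinhSeries, one_eq_egf]
  simp only [C_mul_egf, egf_add, egf_mul, ← Finset.sum_add_distrib]
  congr 1
  ext n
  by_cases hn : 1 ≤ n ∧ Even n
  · rw [if_pos hn, refinedEulerianPoly_eq_weightSum, weightSum_eq_sum_antidiagonal _ (by omega)]
    refine Finset.sum_congr rfl fun i hi => ?_
    obtain ⟨k, m⟩ := i
    obtain rfl : k + m = n := by simpa using hi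
    simp only [refinedEulerianPoly_eq_weightSum]
    rcases k with _ | k
    · simp
    · simp only [Nat.add_sub_cancel, descentFactor]
      rcases Nat.even_or_odd m with hm | hm
      · have hk : Odd k := by grind
        have hm' : ¬ Odd m := by grind
        rw [prod_one_sub_parityWeight_of_even p q hm, ← hc]
        have e : (k + 1) / 2 - 1 = k / 2 := by grind
        rcases m with _ | m
        · simp [hk, Nat.not_even_iff_odd.mpr hk, e]
        · simp [hk, Nat.not_even_iff_odd.mpr hk, e, hm, parityWeight, hm']
      · have hk : Even k := by grind
        have hm' : ¬ Even m := by grind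
        have hm0 : m ≠ 0 := by grind
        rw [prod_one_sub_parityWeight_of_odd p q hm, ← hc]
        have e : (k + 1) / 2 = k / 2 := by grind
        simp [hk, Nat.even_add_one, e, hm, parityWeight, hm0]
  · rw [if_neg hn]
    refine (Finset.sum_eq_zero fun i hi => ?_).symm
    obtain ⟨k, m⟩ := i
    obtain rfl : k + m = n := by simpa using hi
    rcases Nat.even_or_odd k with hk | hk
    · rcases k with _ | k
      · simp
      · have h1 : ¬ Even m := by grind
        have h2 : m ≠ 0 := by grind
        simp [Nat.not_odd_iff_even.mpr hk, h1, h2]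
    · have h1 : ¬ Odd m := by grind
      simp [Nat.not_even_iff_odd.mpr hk, h1]

/-- Here `k` and `m` have opposite parity; for even `k` the unpaired factor is `1 - q`, since
position `m + 1` is even. -/
theorem oddEGF_linear (p q : R) :
    oddEGF p q = sinhSeries ((1 - p) * (1 - q)) * (1 + PowerSeries.C q * evenEGF p q) +
      PowerSeries.C (1 - q) * coshSeries ((1 - p) * (1 - q)) *
        (PowerSeries.C p * oddEGF p q) := by
  set c := (1 - p) * (1 - q) with hc
  rw [evenEGF_eq_egf, oddEGF_eq_egf, coshSeries, sinhSeries, one_eq_egf]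
  simp only [C_mul_egf, egf_add, egf_mul, ← Finset.sum_add_distrib]
  congr 1
  ext n
  by_cases hn : Odd n
  · rw [if_pos hn, refinedEulerianPoly_eq_weightSum, weightSum_eq_sum_antidiagonal _ (by grind)]
    refine Finset.sum_congr rfl fun i hi => ?_
    obtain ⟨k, m⟩ := i
    obtain rfl : k + m = n := by simpa using hi
    simp only [refinedEulerianPoly_eq_weightSum]
    rcases k with _ | k
    · simp
    · simp only [Nat.add_sub_cancel, descentFactor]
      rcases Nat.even_or_odd m with hm | hm
      · have hk : Even k := by grind
        have hm' : ¬ Odd m := by grind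
        rw [prod_one_sub_parityWeight_of_even p q hm, ← hc]
        have e : (k + 1) / 2 = k / 2 := by grind
        rcases m with _ | m
        · simp [hk, Nat.even_add_one, e]
        · simp [hk, Nat.even_add_one, e, hm, parityWeight, hm']
      · have hk : Odd k := by grind
        have hm0 : m ≠ 0 := by grind
        rw [prod_one_sub_parityWeight_of_odd p q hm, ← hc]
        have e : (k + 1) / 2 - 1 = k / 2 := by grind
        simp [hk, Nat.not_even_iff_odd.mpr hk, e, hm, parityWeight, hm0]
  · rw [if_neg hn]
    refine (Finset.sum_eq_zero fun i hi => ?_).symm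
    obtain ⟨k, m⟩ := i
    obtain rfl : k + m = n := by simpa using hi
    rcases Nat.even_or_odd k with hk | hk
    · have h1 : ¬ Odd m := by grind
      simp [Nat.not_odd_iff_even.mpr hk, h1]
    · have h1 : ¬ Even m := by grind
      have h2 : m ≠ 0 := by grind
      simp [Nat.not_even_iff_odd.mpr hk, h1, h2]

/-- The common denominator of the even and the odd generating function. -/
noncomputable def egfDenom (p q : R) : PowerSeries R :=
  1 - PowerSeries.C (p + q) * coshSeries ((1 - p) * (1 - q))

theorem isUnit_egfDenom (p q : R) : IsUnit (egfDenom p q) := by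
  rw [PowerSeries.isUnit_iff_constantCoeff]
  simp [egfDenom]

/-- The right side is the determinant of the linear system; `sinhSeries_sq` cancels its quadratic
terms. The next two results are Cramer's rule. -/
theorem egfDenom_eq (p q : R) :
    egfDenom p q = (1 - PowerSeries.C (1 - p) * PowerSeries.C q * coshSeries ((1 - p) * (1 - q))) *
        (1 - PowerSeries.C (1 - q) * PowerSeries.C p * coshSeries ((1 - p) * (1 - q))) -
      PowerSeries.C p * PowerSeries.C q * sinhSeries ((1 - p) * (1 - q)) ^ 2 := by
  rw [sinhSeries_sq, egfDenom]
  simp only [map_add, map_sub, map_mul, map_one]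
  ring

theorem evenEGF_mul_egfDenom (p q : R) :
    evenEGF p q * egfDenom p q = PowerSeries.C (1 + p) * coshSeries ((1 - p) * (1 - q)) := by
  have he := evenEGF_linear p q
  have ho := oddEGF_linear p q
  have hs := sinhSeries_sq ((1 - p) * (1 - q))
  rw [egfDenom_eq]
  simp only [map_add, map_sub, map_mul, map_one] at *
  set c := PowerSeries.C p
  set d := PowerSeries.C q
  set H := coshSeries ((1 - p) * (1 - q))
  set S := sinhSeries ((1 - p) * (1 - q))
  linear_combination (1 - (1 - d) * c * H) * he + S * c * ho + c * hs

theorem oddEGF_mul_egfDenom (p q : R) :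
    oddEGF p q * egfDenom p q = sinhSeries ((1 - p) * (1 - q)) := by
  have he := evenEGF_linear p q
  have ho := oddEGF_linear p q
  rw [egfDenom_eq]
  simp only [map_sub, map_one] at *
  set c := PowerSeries.C p
  set d := PowerSeries.C q
  set H := coshSeries ((1 - p) * (1 - q))
  set S := sinhSeries ((1 - p) * (1 - q))
  linear_combination (1 - (1 - c) * d * H) * ho + S * d * he

theorem rescale_coshSeries (s c : R) :
    PowerSeries.rescale s (coshSeries c) =
      PowerSeries.C (s ^ 2) * coshSeries (s ^ 2 * c) := by
  ext n
  simp only [coshSeries, PowerSeries.coeff_rescale, PowerSeries.coeff_C_mul, coeff_egf]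
  split_ifs with h
  · obtain ⟨h1, l, rfl⟩ := h
    obtain ⟨m, rfl⟩ : ∃ m, l = m + 1 := ⟨l - 1, by omega⟩
    rw [show (m + 1 + (m + 1)) / 2 - 1 = m by omega]
    simp only [mul_smul_comm]
    congr 1
    ring
  · simp

theorem rescale_sinhSeries (s c : R) :
    PowerSeries.rescale s (sinhSeries c) = PowerSeries.C s * sinhSeries (s ^ 2 * c) := by
  ext n
  simp only [sinhSeries, PowerSeries.coeff_rescale, PowerSeries.coeff_C_mul, coeff_egf]
  split_ifs with h
  · obtain ⟨m, rfl⟩ := h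
    rw [show (2 * m + 1) / 2 = m by omega]
    simp only [mul_smul_comm]
    congr 1
    ring
  · simp

theorem eulerianEGF_eq (x : R) : eulerianEGF x = 1 + evenEGF x x + oddEGF x x := by
  ext n
  simp only [eulerianEGF, evenEGF, oddEGF, PowerSeries.coeff_mk, map_add, PowerSeries.coeff_one,
    refinedEulerianPoly_self]
  rcases n with _ | n
  · simp [eulerianPoly, des, descents]
  · rcases Nat.even_or_odd (n + 1) with h | h
    · simp [h]
    · simp [h, Nat.not_even_iff_odd.mpr h]

theorem rescale_neg_evenEGF (s p q : R) :
    PowerSeries.rescale (-s) (evenEGF p q) = PowerSeries.rescale s (evenEGF p q) := by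
  ext n
  simp only [PowerSeries.coeff_rescale, evenEGF, PowerSeries.coeff_mk]
  split_ifs with h
  · rw [h.2.neg_pow]
  · simp

theorem rescale_neg_oddEGF (s p q : R) :
    PowerSeries.rescale (-s) (oddEGF p q) = -PowerSeries.rescale s (oddEGF p q) := by
  ext n
  simp only [map_neg, PowerSeries.coeff_rescale, oddEGF, PowerSeries.coeff_mk]
  split_ifs with h
  · rw [h.neg_pow, neg_mul]
  · simp

theorem rescale_add_rescale_neg_eulerianEGF (s x : R) :
    (1 / 2 : ℚ) • (PowerSeries.rescale s (eulerianEGF x) +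
      PowerSeries.rescale (-s) (eulerianEGF x)) - 1 = PowerSeries.rescale s (evenEGF x x) := by
  rw [eulerianEGF_eq]
  simp only [map_add, map_one, rescale_neg_evenEGF, rescale_neg_oddEGF]
  module

theorem rescale_sub_rescale_neg_eulerianEGF (s x : R) :
    PowerSeries.rescale s (eulerianEGF x) - PowerSeries.rescale (-s) (eulerianEGF x) =
      2 * PowerSeries.rescale s (oddEGF x x) := by
  rw [eulerianEGF_eq]
  simp only [map_add, map_one, rescale_neg_evenEGF, rescale_neg_oddEGF]
  ring

theorem rescale_exp_eq (a : R) :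
    PowerSeries.rescale a (PowerSeries.exp R) = 1 + PowerSeries.C (a ^ 2) * coshSeries (a ^ 2) +
      PowerSeries.C a * sinhSeries (a ^ 2) := by
  have h : PowerSeries.rescale a (PowerSeries.exp R) = egf fun n => a ^ n := by
    ext n
    simp [PowerSeries.coeff_exp, Algebra.smul_def, mul_comm]
  rw [h, one_eq_egf, coshSeries, sinhSeries]
  simp only [C_mul_egf, egf_add]
  congr 1
  ext n
  rcases n with _ | n
  · simp
  · rcases Nat.even_or_odd' n with ⟨l, rfl | rfl⟩
    · simp [show (2 * l + 1) / 2 = l by omega]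
      ring
    · have h : ¬ Odd (2 * l + 1 + 1) := by grind
      simp [Nat.even_add_one, h, show (2 * l + 1 + 1) / 2 - 1 = l by omega]
      ring

/-- The case `p = q = x` of the solved system. Only `egfDenom x x` is cancelled, which is always a
unit, so `x = 1` needs no separate treatment. -/
theorem eulerianEGF_mul_exp_sub (x : R) :
    eulerianEGF x * (PowerSeries.rescale (x - 1) (PowerSeries.exp R) - PowerSeries.C x) =
      PowerSeries.C (1 - x) := by
  refine (isUnit_egfDenom x x).mul_right_cancel ?_
  have he := evenEGF_mul_egfDenom x x
  have ho := oddEGF_mul_egfDenom x x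
  have hs := sinhSeries_sq ((1 - x) * (1 - x))
  rw [eulerianEGF_eq, rescale_exp_eq, show (x - 1) ^ 2 = (1 - x) * (1 - x) by ring]
  have hd : egfDenom x x = 1 - PowerSeries.C (x + x) * coshSeries ((1 - x) * (1 - x)) := rfl
  simp only [map_add, map_sub, map_mul, map_one] at *
  set c := PowerSeries.C x
  set H := coshSeries ((1 - x) * (1 - x))
  set S := sinhSeries ((1 - x) * (1 - x))
  linear_combination (1 + (1 - c) * (1 - c) * H + (c - 1) * S - c) * (he + ho + hd) -
    (1 - c) * hs - (1 - c) * hd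

/-- The specialisation of the refined generating functions to the classical ones. -/
theorem egf_eq_rescale {p q x s : R} (h1 : 2 * x * s ^ 2 = p + q)
    (h2 : (1 + x ^ 2) * s ^ 2 = 1 + p * q) :
    PowerSeries.C (1 + q) * evenEGF p q =
        PowerSeries.C (1 + x) * PowerSeries.rescale s (evenEGF x x) ∧
      PowerSeries.C s * oddEGF p q = PowerSeries.rescale s (oddEGF x x) := by
  -- The difference of the two hypotheses matches the parameter `c`; their sum, `(1+x)²s² =
  -- (1+p)(1+q)`, will match the numerators.
  have hc : s ^ 2 * ((1 - x) * (1 - x)) = (1 - p) * (1 - q) := by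
    linear_combination h2 - h1
  have hd : PowerSeries.rescale s (egfDenom x x) = egfDenom p q := by
    rw [egfDenom, egfDenom, map_sub, map_mul, map_one, rescale_coshSeries, hc,
      rescale_C, ← mul_assoc, ← map_mul, ← h1]
    congr 4
    ring
  have he := congrArg (PowerSeries.rescale s) (evenEGF_mul_egfDenom x x)
  have ho := congrArg (PowerSeries.rescale s) (oddEGF_mul_egfDenom x x)
  rw [map_mul, hd] at he ho
  rw [map_mul, rescale_C, rescale_coshSeries, hc] at he
  rw [rescale_sinhSeries, hc] at ho
  constructor
  · refine (isUnit_egfDenom p q).mul_right_cancel ?_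
    rw [mul_assoc, mul_assoc, he, evenEGF_mul_egfDenom]
    simp only [← mul_assoc, ← map_mul]
    congr 2
    linear_combination -h1 - h2
  · refine (isUnit_egfDenom p q).mul_right_cancel ?_
    rw [mul_assoc, ho, oddEGF_mul_egfDenom]

end EGF

/-! ### Solving for `x` and `s`, formally and over `ℂ` -/

section Formal

variable {σ : Type*}

theorem formalCatalan_eq {g : MvPowerSeries σ ℚ} (hg : MvPowerSeries.constantCoeff g = 0) :
    formalCatalan g = 1 + g * formalCatalan g ^ 2 := by
  have hs : PowerSeries.HasSubst g := PowerSeries.HasSubst.of_constantCoeff_zero hg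
  have hc : catalanGF ^ 2 * PowerSeries.X + 1 = catalanGF := by
    have h := congrArg (PowerSeries.map (Nat.castRingHom ℚ))
      PowerSeries.catalanSeries_sq_mul_X_add_one
    simpa [catalanGF] using h
  have h := congrArg (PowerSeries.substAlgHom (R := ℚ) hs) hc
  rw [map_add, map_mul, map_pow, map_one, PowerSeries.coe_substAlgHom, PowerSeries.subst_X hs] at h
  rw [formalCatalan]
  linear_combination -h

theorem constantCoeff_two : MvPowerSeries.constantCoeff (2 : MvPowerSeries σ ℚ) = 2 :=
  map_ofNat _ 2

/-- Multiplying the Catalan equation at `y²` by `y` gives `x = y(1+x²)`; then `s²` is determined by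
either of the two relations. -/
theorem formal_parametrization {p q y x s : MvPowerSeries σ ℚ}
    (hp : MvPowerSeries.constantCoeff p = 0) (hq : MvPowerSeries.constantCoeff q = 0)
    (hy : y = (p + q) * (2 * (1 + p * q))⁻¹) (hx : x = y * formalCatalan (y ^ 2))
    (hs : s = formalSqrt ((1 + p * q) * (1 + x ^ 2)⁻¹)) :
    2 * x * s ^ 2 = p + q ∧ (1 + x ^ 2) * s ^ 2 = 1 + p * q ∧
      MvPowerSeries.constantCoeff s ≠ 0 := by
  have hy0 : MvPowerSeries.constantCoeff y = 0 := by simp [hy, hp, hq]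
  have hx0 : MvPowerSeries.constantCoeff x = 0 := by simp [hx, hy0]
  have hpq : 2 * (1 + p * q) * (2 * (1 + p * q))⁻¹ = 1 :=
    MvPowerSeries.mul_inv_cancel _ (by simp [hp, constantCoeff_two])
  have hx2 : (1 + x ^ 2) * (1 + x ^ 2)⁻¹ = 1 :=
    MvPowerSeries.mul_inv_cancel _ (by simp [hx0])
  have hss : s ^ 2 = (1 + p * q) * (1 + x ^ 2)⁻¹ := by
    rw [hs]
    exact formalSqrt_sq _ (by simp [hp, hx0])
  have hxy : x = y * (1 + x ^ 2) := by
    have h := formalCatalan_eq (g := y ^ 2) (by simp [hy0])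
    rw [hx]
    linear_combination y * h
  refine ⟨?_, ?_, ?_⟩
  · linear_combination 2 * x * hss + 2 * (1 + p * q) * (1 + x ^ 2)⁻¹ * hxy +
      2 * y * (1 + p * q) * hx2 + 2 * (1 + p * q) * hy + (p + q) * hpq
  · linear_combination (1 + x ^ 2) * hss + (1 + p * q) * hx2
  · intro h
    have := congrArg MvPowerSeries.constantCoeff hss
    simp [h, hp, hx0] at this

end Formal

theorem sq_complexSqrt (z : ℂ) : Complex.sqrt z ^ 2 = z := by
  simp [Complex.sqrt]

theorem complexCatalan_eq (z : ℂ) : complexCatalan z = 1 + z * complexCatalan z ^ 2 := by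
  unfold complexCatalan
  split_ifs with h
  · simp [h]
  · have hs : Complex.sqrt (1 - 4 * z) ^ 2 = 1 - 4 * z := sq_complexSqrt _
    field_simp
    linear_combination -hs

/-- Only `x = y(1+x²)` and the value of `s²` are used, so the choice of branches plays no role. -/
theorem complex_parametrization {p q y x s : ℂ} (hpq : 1 + p * q ≠ 0)
    (hy : y = (p + q) / (2 * (1 + p * q))) (hx : x = y * complexCatalan (y ^ 2))
    (hs : s = Complex.sqrt ((1 + p * q) / (1 + x ^ 2))) :
    2 * x * s ^ 2 = p + q ∧ (1 + x ^ 2) * s ^ 2 = 1 + p * q ∧ s ≠ 0 := by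
  have hxy : x = y * (1 + x ^ 2) := by
    have h := complexCatalan_eq (y ^ 2)
    rw [hx]
    linear_combination y * h
  -- If `1 + x²` vanished, `x = y(1+x²)` would force `x = 0`, which makes it 1.
  have hx2 : 1 + x ^ 2 ≠ 0 := by
    intro h
    rw [h, mul_zero] at hxy
    simp [hxy] at h
  have hss : s ^ 2 = (1 + p * q) / (1 + x ^ 2) := by
    rw [hs]
    exact sq_complexSqrt _
  have hy' : y * (2 * (1 + p * q)) = p + q := by
    rw [hy]
    field_simp
  have h2 : (1 + x ^ 2) * s ^ 2 = 1 + p * q := by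
    rw [hss]
    field_simp
  refine ⟨?_, h2, ?_⟩
  · linear_combination 2 * s ^ 2 * hxy + 2 * y * h2 + hy'
  · rintro rfl
    exact hpq (by simpa using h2.symm)

/-- Inverses enter only through `hu` and `hv`, so one argument serves both the power series ring and
`ℂ`. -/
theorem egf_eq_of_mul_eq_one {R : Type*} [CommRing R] [Algebra ℚ R] {p q x s u v : R}
    (h1 : 2 * x * s ^ 2 = p + q) (h2 : (1 + x ^ 2) * s ^ 2 = 1 + p * q)
    (hu : (1 + q) * u = 1) (hv : 2 * s * v = 1) :
    evenEGF p q = PowerSeries.C ((1 + x) * u) *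
        ((1 / 2 : ℚ) • (PowerSeries.rescale s (eulerianEGF x) +
          PowerSeries.rescale (-s) (eulerianEGF x)) - 1) ∧
      oddEGF p q = PowerSeries.C v *
        (PowerSeries.rescale s (eulerianEGF x) - PowerSeries.rescale (-s) (eulerianEGF x)) := by
  obtain ⟨he, ho⟩ := egf_eq_rescale h1 h2
  have hu' := congrArg PowerSeries.C hu
  have hv' := congrArg PowerSeries.C hv
  have h2' : (PowerSeries.C 2 : PowerSeries R) = 2 := map_ofNat _ 2
  rw [rescale_add_rescale_neg_eulerianEGF, rescale_sub_rescale_neg_eulerianEGF]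
  simp only [map_mul, map_one, h2'] at hu' hv' ⊢
  exact ⟨by linear_combination PowerSeries.C u * he - evenEGF p q * hu',
    by linear_combination 2 * PowerSeries.C v * ho - oddEGF p q * hv'⟩

end RefinedEulerian

theorem theorem2p2 :
    -- `p`, `q` indeterminates: an identity of power series in `p`, `q`, `t`
    (∀ p q y x s : MvPowerSeries (Fin 2) ℚ,
      p = MvPowerSeries.X 0 → q = MvPowerSeries.X 1 →
      y = (p + q) * (2 * (1 + p * q))⁻¹ →
      x = y * RefinedEulerian.formalCatalan (y ^ 2) →
      s = RefinedEulerian.formalSqrt ((1 + p * q) * (1 + x ^ 2)⁻¹) →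
      RefinedEulerian.evenEGF p q =
          PowerSeries.C ((1 + x) * (1 + q)⁻¹) *
            ((1 / 2 : ℚ) • (PowerSeries.rescale s (RefinedEulerian.eulerianEGF x) +
              PowerSeries.rescale (-s) (RefinedEulerian.eulerianEGF x)) - 1) ∧
      RefinedEulerian.oddEGF p q =
          PowerSeries.C ((2 * s)⁻¹) *
            (PowerSeries.rescale s (RefinedEulerian.eulerianEGF x) -
              PowerSeries.rescale (-s) (RefinedEulerian.eulerianEGF x)) ∧
      RefinedEulerian.eulerianEGF x *
          (PowerSeries.rescale (x - 1) (PowerSeries.exp (MvPowerSeries (Fin 2) ℚ)) -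
            PowerSeries.C x) = PowerSeries.C (1 - x)) ∧
    -- `p`, `q` complex numbers: an identity of power series in `t`
    (∀ p q y x s : ℂ, 1 + p * q ≠ 0 → 1 + q ≠ 0 →
      y = (p + q) / (2 * (1 + p * q)) →
      x = y * RefinedEulerian.complexCatalan (y ^ 2) →
      s = Complex.sqrt ((1 + p * q) / (1 + x ^ 2)) →
      RefinedEulerian.evenEGF p q =
          PowerSeries.C ((1 + x) / (1 + q)) *
            ((1 / 2 : ℚ) • (PowerSeries.rescale s (RefinedEulerian.eulerianEGF x) +
              PowerSeries.rescale (-s) (RefinedEulerian.eulerianEGF x)) - 1) ∧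
      RefinedEulerian.oddEGF p q =
          PowerSeries.C (1 / (2 * s)) *
            (PowerSeries.rescale s (RefinedEulerian.eulerianEGF x) -
              PowerSeries.rescale (-s) (RefinedEulerian.eulerianEGF x)) ∧
      RefinedEulerian.eulerianEGF x *
          (PowerSeries.rescale (x - 1) (PowerSeries.exp ℂ) - PowerSeries.C x) =
        PowerSeries.C (1 - x)) := by
  refine ⟨?_, ?_⟩
  · intro p q y x s hp hq hy hx hs
    have hp0 : MvPowerSeries.constantCoeff p = 0 := by simp [hp]
    have hq0 : MvPowerSeries.constantCoeff q = 0 := by simp [hq]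
    obtain ⟨h1, h2, h0⟩ := RefinedEulerian.formal_parametrization hp0 hq0 hy hx hs
    obtain ⟨he, ho⟩ := RefinedEulerian.egf_eq_of_mul_eq_one h1 h2
      (MvPowerSeries.mul_inv_cancel (1 + q) (by simp [hq0]))
      (MvPowerSeries.mul_inv_cancel (2 * s) (by simpa [RefinedEulerian.constantCoeff_two] using h0))
    exact ⟨he, ho, RefinedEulerian.eulerianEGF_mul_exp_sub x⟩
  · intro p q y x s hpq hq hy hx hs
    obtain ⟨h1, h2, h0⟩ := RefinedEulerian.complex_parametrization hpq hy hx hs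
    obtain ⟨he, ho⟩ := RefinedEulerian.egf_eq_of_mul_eq_one h1 h2 (mul_inv_cancel₀ hq)
      (mul_inv_cancel₀ (mul_ne_zero two_ne_zero h0))
    rw [← div_eq_mul_inv] at he
    rw [← one_div] at ho
    exact ⟨he, ho, RefinedEulerian.eulerianEGF_mul_exp_sub x⟩
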